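/- Let $n\ge 3$, let $\mathbb N=\{1,2,\dots\}$ and let $Y_n=\{1,\dots,n\}\times\mathbb N$ be the disjoint union of $n$ rays. Houghton's group $\mathcal H_n$ is the group of all bijections $g:Y_n\to Y_n$ for which there are $(m_1,\dots,m_n)\in\mathbb Z^n$ and a finite set $K\subset Y_n$ with $(k,p)\cdot g=(k,p+m_k)$ for all $(k,p)\in Y_n\setminus K$; it acts on the right, so $gh$ means $g$ followed by $h$. For $1\le i\le n-1$ let $g_i\in\mathcal H_n$ be given by $(1,p)g_i=(1,p-1)$ for $p\ge 2$, $(1,1)g_i=(i+1,1)$, $(i+1,p)g_i=(i+1,p+1)$, and $(j,p)g_i=(j,p)$ for $j\ne 1,i+1$; let $\alpha\in\mathcal H_n$ be the transposition exchanging $(1,1)$ and $(1,2)$. Write $a^h=h^{-1}ah$ and $[a,b]=aba^{-1}b^{-1}$. Then $\mathcal H_n$ has the finite presentation with generators $g_1,\dots,g_{n-1},\alpha$ and defining relations $$\alpha^2=1,\qquad (\alpha\,\alpha^{g_1})^3=1,\qquad [\alpha,\alpha^{g_1^{-2}}]=1,$$ $$[g_i,g_j]=\alpha,\qquad \alpha^{g_i^{-1}}=\alpha^{g_j^{-1}}\qquad\text{for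 all } 1\le i\ne j\le n-1.$$ More precisely, the group defined by this presentation is isomorphic to $\mathcal H_n$ by an isomorphism sending each abstract generator to the element of $\mathcal H_n$ of the same name. -/

import Mathlib

namespace Houghton

open scoped commutatorElement

/-- The disjoint union of `n` rays, each a copy of the positive integers: `(k, p)` is the point
at distance `p` from the origin on the ray with index `k`. The ray called number `k + 1` in
one-based numbering has index `k`, so the first ray has index `0`. -/
abbrev Rays (n : ℕ) : Type := Fin n × ℕ+

/-- `g` is an eventual translation: outside a finite set it maps `(k, p)` to `(k, p + m k)`. -/
def IsEventualTranslation {n : ℕ} (g : Equiv.Perm (Rays n)) : Prop :=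
  ∃ (m : Fin n → ℤ) (K : Set (Rays n)), K.Finite ∧
    ∀ (k : Fin n) (p : ℕ+), (k, p) ∉ K →
      (g (k, p)).1 = k ∧ (((g (k, p)).2 : ℕ) : ℤ) = ((p : ℕ) : ℤ) + m k

theorem IsEventualTranslation.one (n : ℕ) :
    IsEventualTranslation (1 : Equiv.Perm (Rays n)) :=
  ⟨0, ∅, Set.finite_empty, fun k p _ => by simp⟩

/-- `h * g` is `g` followed by `h`. -/
theorem IsEventualTranslation.mul {n : ℕ} {h g : Equiv.Perm (Rays n)}
    (hh : IsEventualTranslation h) (hg : IsEventualTranslation g) :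
    IsEventualTranslation (h * g) := by
  obtain ⟨m, K, hK, hm⟩ := hg
  obtain ⟨m', K', hK', hm'⟩ := hh
  refine ⟨m + m', K ∪ g ⁻¹' K', hK.union (hK'.preimage g.injective.injOn), fun k p hp => ?_⟩
  simp only [Set.mem_union, Set.mem_preimage, not_or] at hp
  obtain ⟨h1, h2⟩ := hm k p hp.1
  have e : g (k, p) = (k, (g (k, p)).2) := Prod.ext h1 rfl
  have hp2 := hp.2
  rw [e] at hp2
  obtain ⟨h3, h4⟩ := hm' k _ hp2
  rw [← e] at h3 h4
  refine ⟨h3, ?_⟩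
  rw [Equiv.Perm.mul_apply, h4, h2, Pi.add_apply]
  ring

theorem IsEventualTranslation.inv {n : ℕ} {g : Equiv.Perm (Rays n)}
    (hg : IsEventualTranslation g) : IsEventualTranslation g⁻¹ := by
  obtain ⟨m, K, hK, hm⟩ := hg
  -- Besides the image of `K`, discard the points not of the form `(k, q + m k)` with `q` positive.
  refine ⟨-m, g '' K ∪ {x | ((x.2 : ℕ) : ℤ) ≤ m x.1}, (hK.image g).union ?_, fun k p hp => ?_⟩
  · refine (Set.Finite.subset (Set.finite_iUnion (fun k : Fin n =>
      (Set.finite_Iic (⟨(m k).toNat + 1, Nat.succ_pos _⟩ : ℕ+)).image (fun p => (k, p)))) ?_)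
    rintro ⟨k, p⟩ hx
    refine Set.mem_iUnion.2 ⟨k, p, ?_, rfl⟩
    change ((p : ℕ) : ℤ) ≤ m k at hx
    change (p : ℕ) ≤ (m k).toNat + 1
    omega
  · rw [Set.mem_union, not_or] at hp
    obtain ⟨hp1, hp2⟩ := hp
    replace hp2 : ¬ ((p : ℕ) : ℤ) ≤ m k := hp2
    have key : (g⁻¹ (k, p)) ∉ K := fun hmem => hp1 ⟨_, hmem, by simp⟩
    obtain ⟨h1, h2⟩ := hm (g⁻¹ (k, p)).1 (g⁻¹ (k, p)).2 key
    have e : g ((g⁻¹ (k, p)).1, (g⁻¹ (k, p)).2) = (k, p) := by simp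
    rw [e] at h1 h2
    simp only at h1 h2
    rw [← h1] at h2
    refine ⟨h1.symm, ?_⟩
    rw [Pi.neg_apply]
    omega

/-- Houghton's group: all eventual translations of the `n` rays. It acts on the right, that is,
a product `g * h` is `g` followed by `h`; this is the multiplication of the opposite of
`Equiv.Perm`, where `MulOpposite.op g * MulOpposite.op h = MulOpposite.op (h * g)` and
`(h * g) x = h (g x)`. -/
def group (n : ℕ) : Subgroup (Equiv.Perm (Rays n))ᵐᵒᵖ where
  carrier := {g | IsEventualTranslation g.unop}
  one_mem' := IsEventualTranslation.one n
  mul_mem' hg hh := IsEventualTranslation.mul hh hg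
  inv_mem' hg := IsEventualTranslation.inv hg

/-- The index of the first ray. -/
def firstRay {n : ℕ} (i : Fin (n - 1)) : Fin n := ⟨0, by have := i.isLt; omega⟩

/-- For the generator number `i + 1`, the index of the ray number `i + 2`
in one-based numbering. -/
def otherRay {n : ℕ} (i : Fin (n - 1)) : Fin n := ⟨(i : ℕ) + 1, by have := i.isLt; omega⟩

theorem otherRay_ne {n : ℕ} (i : Fin (n - 1)) : otherRay i ≠ firstRay i := by
  simp [otherRay, firstRay]

/-- The translation by `1` along the line formed by the first ray and another ray, towards the
other ray; all other rays are fixed. -/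
def shiftPerm (n : ℕ) (i : Fin (n - 1)) : Equiv.Perm (Rays n) where
  toFun x :=
    if x.1 = firstRay i then
      if x.2 = 1 then (otherRay i, 1) else (firstRay i, x.2 - 1)
    else if x.1 = otherRay i then (otherRay i, x.2 + 1)
    else x
  invFun x :=
    if x.1 = firstRay i then (firstRay i, x.2 + 1)
    else if x.1 = otherRay i then
      if x.2 = 1 then (firstRay i, 1) else (otherRay i, x.2 - 1)
    else x
  left_inv := by
    rintro ⟨k, p⟩
    have hne := otherRay_ne i
    have hp1 : p + 1 ≠ 1 := (PNat.lt_add_left 1 p).ne'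
    by_cases h1 : k = firstRay i
    · by_cases hp : p = 1
      · simp [h1, hp, hne]
      · have : p - 1 + 1 = p := PNat.sub_add_of_lt (lt_of_le_of_ne one_le (Ne.symm hp))
        simp [h1, hp, this]
    · by_cases h2 : k = otherRay i
      · simp [h2, hne, hp1]
      · simp [h1, h2]
  right_inv := by
    rintro ⟨k, p⟩
    have hne := otherRay_ne i
    have hp1 : p + 1 ≠ 1 := (PNat.lt_add_left 1 p).ne'
    by_cases h1 : k = firstRay i
    · simp [h1, hp1]
    · by_cases h2 : k = otherRay i
      · by_cases hp : p = 1
        · simp [h2, hp, hne]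
        · have : p - 1 + 1 = p := PNat.sub_add_of_lt (lt_of_le_of_ne one_le (Ne.symm hp))
          simp [h2, hp, hne, this]
      · simp [h1, h2]

theorem isEventualTranslation_shiftPerm (n : ℕ) (i : Fin (n - 1)) :
    IsEventualTranslation (shiftPerm n i) := by
  have hne := otherRay_ne i
  refine ⟨fun k => if k = firstRay i then -1 else if k = otherRay i then 1 else 0,
    {(firstRay i, 1)}, Set.finite_singleton _, fun k p hp => ?_⟩
  by_cases h1 : k = firstRay i
  · have hp1 : p ≠ 1 := by
      rintro rfl
      exact hp (by simp [h1])
    have : p - 1 + 1 = p := PNat.sub_add_of_lt (lt_of_le_of_ne one_le (Ne.symm hp1))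
    have h' : ((p - 1 : ℕ+) : ℕ) + 1 = (p : ℕ) := by exact_mod_cast congrArg PNat.val this
    refine ⟨by simp [shiftPerm, h1, hp1], ?_⟩
    simp only [shiftPerm, Equiv.coe_fn_mk, h1, hp1, if_true, if_false]
    omega
  · by_cases h2 : k = otherRay i
    · simp [shiftPerm, h2, hne]
    · simp [shiftPerm, h1, h2]

/-- The elements `g_1, …, g_{n-1}` of Houghton's group; `shift n i` is `g_{i+1}`. -/
def shift (n : ℕ) (i : Fin (n - 1)) : group n :=
  ⟨MulOpposite.op (shiftPerm n i), isEventualTranslation_shiftPerm n i⟩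

theorem isEventualTranslation_swap {n : ℕ} (x y : Rays n) :
    IsEventualTranslation (Equiv.swap x y) := by
  refine ⟨0, {x, y}, Set.toFinite _, fun k p hp => ?_⟩
  simp only [Set.mem_insert_iff, Set.mem_singleton_iff, not_or] at hp
  simp [Equiv.swap_apply_of_ne_of_ne hp.1 hp.2]

/-- The transposition exchanging the first two points of the first ray. -/
def transposition (n : ℕ) (hn : 0 < n) : group n :=
  ⟨MulOpposite.op (Equiv.swap ((⟨0, hn⟩, 1) : Rays n) (⟨0, hn⟩, 2)),
    isEventualTranslation_swap _ _⟩

/-- Abstract generators `g_1, …, g_{n-1}, α`; `Gen.g i` stands for `g_{i+1}`. -/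
inductive Gen (n : ℕ) : Type
  | g (i : Fin (n - 1)) : Gen n
  | alpha : Gen n

/-- The conjugate `a ^ h = h⁻¹ a h`. -/
def conj {G : Type*} [Group G] (a h : G) : G := h⁻¹ * a * h

/-- The words `g_{i+1}` in the free group. -/
def gWord {n : ℕ} (i : Fin (n - 1)) : FreeGroup (Gen n) := FreeGroup.of (Gen.g i)

/-- The word `α` in the free group. -/
def alphaWord (n : ℕ) : FreeGroup (Gen n) := FreeGroup.of Gen.alpha

/-- The relators of the presentation; `⁅a, b⁆ = a * b * a⁻¹ * b⁻¹`. -/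
def relators (n : ℕ) (hn : 3 ≤ n) : Set (FreeGroup (Gen n)) :=
  let α := alphaWord n
  let g₁ : FreeGroup (Gen n) := gWord ⟨0, by omega⟩
  {α ^ 2, (α * conj α g₁) ^ 3, ⁅α, conj α (g₁⁻¹ ^ 2)⁆} ∪
    {w | ∃ i j : Fin (n - 1), i ≠ j ∧ w = ⁅gWord i, gWord j⁆ * α⁻¹} ∪
    {w | ∃ i j : Fin (n - 1), i ≠ j ∧
      w = conj α (gWord i)⁻¹ * (conj α (gWord j)⁻¹)⁻¹}

end Houghton

/-! Let P be the presented group and σ_k = g_1^k α g_1^{-k}, whose image exchanges the points k+1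
and k+2 of the first ray. The relations give g_i σ_k g_i⁻¹ = σ_{k+1} for every i, not only i = 1,
and the σ_k satisfy the Coxeter relations of type A (`Relations.semiconjBy`, `Relations.braid`,
`Relations.commute_sigma`). Hence the subgroup S generated by the σ_k is a copy of the finitary
symmetric group of the first ray and acts faithfully (`CoxeterRelations.eq_one_of_mem_closure`).

If w in P acts trivially, its exponent sum in each g_i vanishes, being a translation length, so w
lies in the commutator subgroup. Each g_i conjugates S into itself and the g_i commute modulo S, so
some conjugate of w lies in S (`exists_conj_mem`). That conjugate also acts trivially, hence is 1,
and so is w.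

For surjectivity, a product of powers of the shifts matches the translation lengths of a given
element on all rays but the first. The first then matches by a counting argument, and the quotient
is finitary, so a product of transpositions, all of which are generated. -/

namespace Houghton

open scoped commutatorElement

/-! ### Consequences of the defining relations -/

section Abstract

/-- Elements `g i` and `a` of a group, with a distinguished index `o`, that satisfy the defining
relations of Houghton's group. -/
structure Relations {G ι : Type*} [Group G] (o : ι) (g : ι → G) (a : G) : Prop where
  sq : a * a = 1
  cube : (a * ((g o)⁻¹ * a * g o)) ^ 3 = 1
  comm : Commute a (g o ^ 2 * a * (g o ^ 2)⁻¹)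
  swap : ∀ i j, i ≠ j → g i * g j = a * (g j * g i)
  conj_eq : ∀ i j, g i * a * (g i)⁻¹ = g j * a * (g j)⁻¹

variable {G ι : Type*} [Group G]

/-- The conjugate of `a` by the `k`-th power of `x⁻¹`. -/
def sigma (x a : G) (k : ℕ) : G := x ^ k * a * (x ^ k)⁻¹

theorem sigma_zero (x a : G) : sigma x a 0 = a := by simp [sigma]

theorem semiconjBy_sigma (x a : G) (k : ℕ) :
    SemiconjBy x (sigma x a k) (sigma x a (k + 1)) := by
  simp only [SemiconjBy, sigma, pow_succ']
  group

namespace Relations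

variable {o : ι} {g : ι → G} {a : G}

theorem inv_eq (h : Relations o g a) : a⁻¹ = a := inv_eq_of_mul_eq_one_left h.sq

theorem sigma_mul_self (h : Relations o g a) (k : ℕ) :
    sigma (g o) a k * sigma (g o) a k = 1 := by
  have : sigma (g o) a k * sigma (g o) a k = g o ^ k * (a * a) * (g o ^ k)⁻¹ := by
    simp only [sigma]; group
  rw [this, h.sq]
  simp

/-- Conjugating the cube relation by `g o` makes it a statement about σ_1 and σ_0; for involutions,
a product of order dividing 3 is the braid relation. -/
theorem braid_zero (h : Relations o g a) :
    a * sigma (g o) a 1 * a = sigma (g o) a 1 * a * sigma (g o) a 1 := by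
  have h1 : (sigma (g o) a 1 * a) ^ 3 = 1 := by
    have : (sigma (g o) a 1 * a) ^ 3 =
        g o * (a * ((g o)⁻¹ * a * g o)) ^ 3 * (g o)⁻¹ := by
      simp only [sigma, pow_succ, pow_zero]; group
    rw [this, h.cube]
    simp
  have h2 := h.sigma_mul_self 1
  have h3 := h.sq
  generalize sigma (g o) a 1 = b at *
  have hb : b⁻¹ = b := inv_eq_of_mul_eq_one_left h2
  have h4 : (b * a * b) * (a * b * a) = 1 := by
    rw [← h1]; simp only [pow_succ, pow_zero, one_mul, mul_assoc]
  rw [eq_inv_of_mul_eq_one_left h4]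
  simp [hb, h.inv_eq, mul_assoc]

theorem braid (h : Relations o g a) (k : ℕ) :
    sigma (g o) a k * sigma (g o) a (k + 1) * sigma (g o) a k =
      sigma (g o) a (k + 1) * sigma (g o) a k * sigma (g o) a (k + 1) := by
  induction k with
  | zero => simpa only [sigma_zero] using h.braid_zero
  | succ k ih =>
    have h1 := semiconjBy_sigma (g o) a k
    have h2 := semiconjBy_sigma (g o) a (k + 1)
    have h3 := (h1.mul_right h2).mul_right h1
    have h4 := (h2.mul_right h1).mul_right h2
    rw [← ih] at h4
    exact mul_right_cancel (h3.symm.trans h4)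

/-- Write `g i` as `a * g o * g i * (g o)⁻¹`: conjugation by these factors, from right to left,
takes σ_{k+1} to σ_k, σ_{k+1}, σ_{k+2}, and finally `a` fixes σ_{k+2}. -/
theorem semiconjBy_succ (h : Relations o g a) {k : ℕ} (i : ι)
    (hk : SemiconjBy (g i) (sigma (g o) a k) (sigma (g o) a (k + 1)))
    (hc : Commute a (sigma (g o) a (k + 2))) :
    SemiconjBy (g i) (sigma (g o) a (k + 1)) (sigma (g o) a (k + 2)) := by
  by_cases hi : i = o
  · rw [hi]; exact semiconjBy_sigma _ _ _
  have h1 := hc.semiconjBy.mul_left ((semiconjBy_sigma (g o) a (k + 1)).mul_left hk)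
  rw [← h.swap i o hi] at h1
  simpa [mul_assoc] using h1.mul_left (semiconjBy_sigma (g o) a k).inv_symm_left

/-- The element b = `(g o)⁻¹ * a * g o` plays the role of σ_{-1}, but its transposition leaves the
first ray, so `g i` takes it to aba instead of σ_0. This is what propagates commutation in the next
induction. -/
theorem semiconjBy_conj_inv (h : Relations o g a) {i : ι} (hi : i ≠ o) :
    SemiconjBy (g i) ((g o)⁻¹ * a * g o) (a * ((g o)⁻¹ * a * g o) * a) := by
  have h0 : SemiconjBy (g i) a (sigma (g o) a 1) := by
    have := h.conj_eq i o
    rw [mul_inv_eq_iff_eq_mul] at this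
    simpa [SemiconjBy, sigma] using this
  have h1 : g i * (g o)⁻¹ = (g o)⁻¹ * a * g i := by
    have := h.swap i o hi
    have e : a * (g i * g o) = g o * g i := by rw [this, ← mul_assoc, h.sq, one_mul]
    rw [mul_inv_eq_iff_eq_mul, mul_assoc, mul_assoc, eq_inv_mul_iff_mul_eq, ← e]
  have h2 : (g o)⁻¹ * sigma (g o) a 1 = a * (g o)⁻¹ := by simp [sigma, mul_assoc]
  have h3 : sigma (g o) a 1 * g o = g o * a := by simp [sigma]
  calc g i * ((g o)⁻¹ * a * g o) = g i * (g o)⁻¹ * a * g o := by simp only [mul_assoc]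
    _ = (g o)⁻¹ * a * (g i * a) * g o := by rw [h1]; simp only [mul_assoc]
    _ = (g o)⁻¹ * a * sigma (g o) a 1 * (g i * g o) := by rw [h0.eq]; simp only [mul_assoc]
    _ = (g o)⁻¹ * (a * sigma (g o) a 1 * a) * g o * g i := by
      rw [h.swap i o hi]; simp only [mul_assoc]
    _ = ((g o)⁻¹ * sigma (g o) a 1) * a * (sigma (g o) a 1 * g o) * g i := by
      rw [h.braid_zero]; simp only [mul_assoc]
    _ = a * ((g o)⁻¹ * a * g o) * a * g i := by rw [h2, h3]; simp only [mul_assoc]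

/-- The two claims feed each other. If a commutes with σ_{k+2}, then b = `(g o)⁻¹ * a * g o`
commutes with σ_{k+1}. Conjugating by some `g i` with i ≠ o, aba commutes with σ_{k+2}, hence so
does b, and conjugating back by `g o`, a commutes with σ_{k+3}. -/
theorem commute_and_semiconjBy [Nontrivial ι] (h : Relations o g a) (k : ℕ) :
    Commute a (sigma (g o) a (k + 2)) ∧
      ∀ i, SemiconjBy (g i) (sigma (g o) a (k + 1)) (sigma (g o) a (k + 2)) := by
  induction k with
  | zero =>
    refine ⟨h.comm, fun i => h.semiconjBy_succ i ?_ h.comm⟩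
    have := h.conj_eq i o
    rw [mul_inv_eq_iff_eq_mul] at this
    simpa [SemiconjBy, sigma] using this
  | succ k ih =>
    obtain ⟨hc, hs⟩ := ih
    have key : Commute a (sigma (g o) a (k + 3)) := by
      obtain ⟨i, hi⟩ := exists_ne o
      have h1 : Commute ((g o)⁻¹ * a * g o) (sigma (g o) a (k + 1)) :=
        ((semiconjBy_sigma (g o) a (k + 1)).inv_symm_left.mul_left hc.semiconjBy |>.mul_left
          (semiconjBy_sigma (g o) a (k + 1)) : SemiconjBy _ _ _)
      have h2 : Commute (a * ((g o)⁻¹ * a * g o) * a) (sigma (g o) a (k + 2)) := by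
        have e1 := (h.semiconjBy_conj_inv hi).mul_right (hs i)
        have e2 := (hs i).mul_right (h.semiconjBy_conj_inv hi)
        rw [← h1.eq] at e2
        exact mul_right_cancel (e1.symm.trans e2)
      have h3 : Commute ((g o)⁻¹ * a * g o) (sigma (g o) a (k + 2)) := by
        have := (hc.mul_left h2).mul_left hc
        rw [← mul_assoc, ← mul_assoc, h.sq, one_mul, mul_assoc, h.sq, mul_one] at this
        exact this
      have h4 := (semiconjBy_sigma (g o) a (k + 2)).mul_left h3.semiconjBy |>.mul_left
          (semiconjBy_sigma (g o) a (k + 2)).inv_symm_left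
      rw [show g o * ((g o)⁻¹ * a * g o) * (g o)⁻¹ = a by group] at h4
      exact h4
    exact ⟨key, fun i => h.semiconjBy_succ i (hs i) key⟩

theorem semiconjBy [Nontrivial ι] (h : Relations o g a) (i : ι) (k : ℕ) :
    SemiconjBy (g i) (sigma (g o) a k) (sigma (g o) a (k + 1)) := by
  cases k with
  | zero =>
    have := h.conj_eq i o
    rw [mul_inv_eq_iff_eq_mul] at this
    simpa [SemiconjBy, sigma] using this
  | succ k => exact (h.commute_and_semiconjBy k).2 i

theorem commute_sigma [Nontrivial ι] (h : Relations o g a) (k l : ℕ) :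
    Commute (sigma (g o) a k) (sigma (g o) a (k + l + 2)) := by
  induction k with
  | zero => simpa only [sigma_zero, zero_add] using (h.commute_and_semiconjBy l).1
  | succ k ih =>
    have e1 := (semiconjBy_sigma (g o) a k).mul_right (semiconjBy_sigma (g o) a (k + l + 2))
    have e2 := (semiconjBy_sigma (g o) a (k + l + 2)).mul_right (semiconjBy_sigma (g o) a k)
    rw [← ih.eq] at e2
    have := mul_right_cancel (e1.symm.trans e2)
    rw [show k + 1 + l + 2 = k + l + 2 + 1 by omega]
    exact this

end Relations

end Abstract

/-! ### Faithfulness of the symmetric group action from the Coxeter relations -/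

section Coxeter

/-- The Coxeter relations of type `A` on a sequence of involutions. -/
structure CoxeterRelations {G : Type*} [Group G] (s : ℕ → G) : Prop where
  mul_self : ∀ k, s k * s k = 1
  braid : ∀ k, s k * s (k + 1) * s k = s (k + 1) * s k * s (k + 1)
  commute : ∀ k l, Commute (s k) (s (k + l + 2))

variable {G : Type*} [Group G] (s : ℕ → G)

/-- The product `s (l + j - 1) * ⋯ * s (l + 1) * s l` of `j` factors. -/
def descending (l : ℕ) : ℕ → G
  | 0 => 1
  | j + 1 => s (l + j) * descending l j

/-- The subgroup generated by the first `m` elements of the sequence `s`. -/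
def initialSubgroup (m : ℕ) : Subgroup G := Subgroup.closure (s '' Set.Iio m)

theorem initialSubgroup_mono : Monotone (initialSubgroup s) := fun _ _ h =>
  Subgroup.closure_mono (Set.image_mono (Set.Iio_subset_Iio h))

theorem mem_initialSubgroup {k m : ℕ} (h : k < m) : s k ∈ initialSubgroup s m :=
  Subgroup.subset_closure ⟨k, h, rfl⟩

theorem descending_succ_mul (l j : ℕ) :
    descending s (l + 1) j * s l = descending s l (j + 1) := by
  induction j with
  | zero => simp [descending]
  | succ j ih =>
    rw [descending, mul_assoc, ih, descending.eq_def s l (j + 1 + 1)]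
    simp only
    rw [show l + 1 + j = l + (j + 1) by omega]

variable {s}

namespace CoxeterRelations

variable (hs : CoxeterRelations s)
include hs

theorem inv_eq (k : ℕ) : (s k)⁻¹ = s k := inv_eq_of_mul_eq_one_left (hs.mul_self k)

theorem commute_of_le {k l : ℕ} (h : k + 2 ≤ l) : Commute (s k) (s l) := by
  obtain ⟨t, rfl⟩ := Nat.exists_eq_add_of_le h
  simpa only [show k + 2 + t = k + t + 2 by omega] using hs.commute k t

theorem commute_descending_of_lt {r l : ℕ} (h : r + 2 ≤ l) (j : ℕ) :
    Commute (s r) (descending s l j) := by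
  induction j with
  | zero => exact Commute.one_right _
  | succ j ih => exact (hs.commute_of_le (by omega)).mul_right ih

theorem commute_descending_of_gt {r l j : ℕ} (h : l + j + 1 ≤ r) :
    Commute (s r) (descending s l j) := by
  induction j with
  | zero => exact Commute.one_right _
  | succ j ih => exact (hs.commute_of_le (by omega)).symm.mul_right (ih (by omega))

/-- Moving leftwards, s_{l+t+1} commutes with the t lowest factors, becomes s_{l+t} by one braid
relation, and then commutes with the u highest factors. -/
theorem descending_mul (l t u : ℕ) :
    descending s l (t + 2 + u) * s (l + t + 1) = s (l + t) * descending s l (t + 2 + u) := by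
  induction u with
  | zero =>
    have h1 := (hs.commute_descending_of_gt (r := l + t + 1) (l := l) (j := t) le_rfl).eq
    calc s (l + t + 1) * (s (l + t) * descending s l t) * s (l + t + 1)
      _ = s (l + t + 1) * s (l + t) * (descending s l t * s (l + t + 1)) := by
        simp only [mul_assoc]
      _ = s (l + t) * s (l + t + 1) * s (l + t) * descending s l t := by
        rw [← h1, hs.braid]; simp only [mul_assoc]
      _ = s (l + t) * (s (l + t + 1) * (s (l + t) * descending s l t)) := by
        simp only [mul_assoc]
  | succ u ih =>
    rw [← add_assoc, descending, mul_assoc, ih, ← mul_assoc, ← mul_assoc,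
      (hs.commute_of_le (k := l + t) (l := l + (t + 2 + u)) (by omega)).eq]

/-- Coset representatives of a standard parabolic subgroup in the next one. -/
theorem exists_descending {m : ℕ} {w : G} (hw : w ∈ initialSubgroup s (m + 1)) :
    ∃ l j, l + j = m + 1 ∧ ∃ v ∈ initialSubgroup s m, w = v * descending s l j := by
  -- The products v · `descending s l j` are closed under right multiplication by s_r: s_r passes
  -- into v unchanged (r + 1 < l), lengthens the descending factor (r + 1 = l), cancels its last
  -- letter (r = l), or passes into v as s_{r-1} (r > l).
  have step : ∀ w : G, ∀ r ≤ m,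
      (∃ l j, l + j = m + 1 ∧ ∃ v ∈ initialSubgroup s m, w = v * descending s l j) →
      ∃ l j, l + j = m + 1 ∧ ∃ v ∈ initialSubgroup s m, w * s r = v * descending s l j := by
    rintro _ r hr ⟨l, j, hlj, v, hv, rfl⟩
    rcases lt_trichotomy (r + 1) l with h | h | h
    · refine ⟨l, j, hlj, v * s r, mul_mem hv (mem_initialSubgroup s (by omega)), ?_⟩
      rw [mul_assoc, mul_assoc, (hs.commute_descending_of_lt (by omega) j).eq]
    · subst h
      exact ⟨r, j + 1, by omega, v, hv, by rw [mul_assoc, descending_succ_mul]⟩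
    · rcases (Nat.lt_succ_iff.1 h).eq_or_lt with rfl | h
      · obtain ⟨j, rfl⟩ : ∃ j', j = j' + 1 := ⟨j - 1, by omega⟩
        refine ⟨l + 1, j, by omega, v, hv, ?_⟩
        rw [← descending_succ_mul, mul_assoc, mul_assoc, hs.mul_self, mul_one]
      · obtain ⟨t, rfl⟩ : ∃ t, r = l + t + 1 := ⟨r - l - 1, by omega⟩
        obtain ⟨u, rfl⟩ : ∃ u, j = t + 2 + u := ⟨j - t - 2, by omega⟩
        refine ⟨l, _, hlj, v * s (l + t), mul_mem hv (mem_initialSubgroup s (by omega)), ?_⟩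
        rw [mul_assoc, hs.descending_mul, mul_assoc]
  refine Subgroup.closure_induction_right ?_ ?_ ?_ hw
  · exact ⟨m + 1, 0, rfl, 1, one_mem _, by simp [descending]⟩
  · rintro x _ y ⟨r, hr, rfl⟩ ih
    exact step x r (Nat.lt_succ_iff.1 hr) ih
  · rintro x _ y ⟨r, hr, rfl⟩ ih
    rw [hs.inv_eq]
    exact step x r (Nat.lt_succ_iff.1 hr) ih

variable {X : Type*} [DecidableEq X] {x : ℕ → X} (hx : Function.Injective x)
  {f : G →* (Equiv.Perm X)ᵐᵒᵖ}
  (hf : ∀ k, f (s k) = MulOpposite.op (Equiv.swap (x k) (x (k + 1))))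
include hx hf

/-- A group generated by involutions satisfying the Coxeter relations of type `A` acts
faithfully as soon as these involutions act as the adjacent transpositions. -/
theorem eq_one_of_mem_closure {w : G} (hw : w ∈ Subgroup.closure (Set.range s))
    (h1 : f w = 1) : w = 1 := by
  have hfix : ∀ m, ∀ v ∈ initialSubgroup s m, ∀ k, m < k → (f v).unop (x k) = x k := by
    intro m v hv k hk
    induction hv using Subgroup.closure_induction with
    | mem y hy =>
      obtain ⟨r, hr, rfl⟩ := hy
      have hr' : r < m := hr
      rw [hf, MulOpposite.unop_op]
      exact Equiv.swap_apply_of_ne_of_ne (hx.ne (by omega)) (hx.ne (by omega))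
    | one => simp
    | mul y z _ _ hy hz => simp [hy, hz]
    | inv y _ hy =>
      rw [map_inv, MulOpposite.unop_inv, Equiv.Perm.inv_eq_iff_eq, hy]
  have hdesc : ∀ l j, (f (descending s l j)).unop (x (l + j)) = x l := by
    intro l j
    induction j with
    | zero => simp [descending]
    | succ j ih =>
      rw [descending, map_mul, MulOpposite.unop_mul, Equiv.Perm.mul_apply, hf,
        MulOpposite.unop_op, ← add_assoc, Equiv.swap_apply_right, ih]
  -- In w = v · `descending s l j`, v acts first and fixes x_{m+1}, which the descending factor then
  -- takes to x_l. If w acts trivially, l = m + 1, the factor is empty, and induction applies to v.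
  have main : ∀ m, ∀ v ∈ initialSubgroup s m, f v = 1 → v = 1 := by
    intro m
    induction m with
    | zero =>
      intro v hv _
      simpa [initialSubgroup] using hv
    | succ m ih =>
      intro w hw h1
      obtain ⟨l, j, hlj, v, hv, rfl⟩ := hs.exists_descending hw
      have h2 : (f (v * descending s l j)).unop (x (m + 1)) = x (m + 1) := by simp [h1]
      rw [map_mul, MulOpposite.unop_mul, Equiv.Perm.mul_apply, hfix m v hv _ (Nat.lt_succ_self m),
        Nat.succ_eq_add_one, ← hlj, hdesc] at h2
      have hj : j = 0 := by have := hx h2; omega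
      subst hj
      simp only [descending, mul_one] at h1 ⊢
      exact ih v hv h1
  have hle : Subgroup.closure (Set.range s) ≤ ⨆ m, initialSubgroup s m := by
    rw [Subgroup.closure_le]
    rintro _ ⟨k, rfl⟩
    exact le_iSup (initialSubgroup s) (k + 1) (mem_initialSubgroup s (Nat.lt_succ_self k))
  obtain ⟨m, hm⟩ := (Subgroup.mem_iSup_of_directed
    (initialSubgroup_mono s).directed_le).1 (hle hw)
  exact main m w hm h1

end CoxeterRelations

end Coxeter

/-! ### Conjugating the commutator subgroup into a contracted subgroup -/

section Contraction

variable {G ι : Type*} [Group G] {S : Subgroup G} {g : ι → G}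

/-- If `S` is mapped into itself by conjugation by elements `g i` that commute modulo `S` and that
generate the whole group together with `S`, then every element of the commutator subgroup has a
conjugate in `S`. -/
theorem exists_conj_mem (hg : ∀ i, ∀ s ∈ S, g i * s * (g i)⁻¹ ∈ S)
    (hc : ∀ i j, ⁅g i, g j⁆ ∈ S) (htop : Subgroup.closure (Set.range g ∪ S) = ⊤) {w : G}
    (hw : w ∈ commutator G) : ∃ q, q * w * q⁻¹ ∈ S := by
  -- Only a submonoid, since inverses of the `g i` need not conjugate S into itself. Any two
  -- elements of Q commute modulo S, which serves as an Ore condition.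
  let Q : Submonoid G := Submonoid.closure (Set.range g ∪ S)
  have hQg : ∀ i, g i ∈ Q := fun i => Submonoid.subset_closure (Or.inl ⟨i, rfl⟩)
  have hQS : ∀ s ∈ S, s ∈ Q := fun s hs => Submonoid.subset_closure (Or.inr hs)
  have hQ : ∀ q ∈ Q, ∀ s ∈ S, q * s * q⁻¹ ∈ S := by
    intro q hq
    induction hq using Submonoid.closure_induction with
    | mem x hx =>
      rcases hx with ⟨i, rfl⟩ | hx
      · exact hg i
      · exact fun s hs => mul_mem (mul_mem hx hs) (inv_mem hx)
    | one => simp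
    | mul x y _ _ hx hy =>
      intro s hs
      rw [show x * y * s * (x * y)⁻¹ = x * (y * s * y⁻¹) * x⁻¹ by group]
      exact hx _ (hy _ hs)
  have hmem : ∀ q ∈ Q, ∀ s ∈ S, ⁅s, q⁆ ∈ S := by
    intro q hq s hs
    rw [commutatorElement_def, mul_assoc s, mul_assoc s]
    exact mul_mem hs (hQ q hq _ (inv_mem hs))
  have hswap : ∀ q q', ⁅q', q⁆ ∈ S → ⁅q, q'⁆ ∈ S := by
    intro q q' h
    rw [← commutatorElement_inv]
    exact inv_mem h
  have hmul : ∀ q, ∀ x ∈ Q, ∀ y ∈ Q, ⁅x, q⁆ ∈ S → ⁅y, q⁆ ∈ S → ⁅x * y, q⁆ ∈ S := by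
    intro q x hx y _ h1 h2
    rw [show ⁅x * y, q⁆ = x * ⁅y, q⁆ * x⁻¹ * ⁅x, q⁆ by simp only [commutatorElement_def]; group]
    exact mul_mem (hQ x hx _ h2) h1
  have hgQ : ∀ i, ∀ q ∈ Q, ⁅q, g i⁆ ∈ S := by
    intro i q hq
    induction hq using Submonoid.closure_induction with
    | mem x hx =>
      rcases hx with ⟨j, rfl⟩ | hx
      · exact hc j i
      · exact hmem _ (hQg i) x hx
    | one => simp
    | mul x y hx hy h1 h2 => exact hmul _ x hx y hy h1 h2
  have hcomm : ∀ q' ∈ Q, ∀ q ∈ Q, ⁅q, q'⁆ ∈ S := by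
    intro q' hq' q hq
    induction hq using Submonoid.closure_induction with
    | mem x hx =>
      rcases hx with ⟨j, rfl⟩ | hx
      · exact hswap _ _ (hgQ j q' hq')
      · exact hmem _ hq' x hx
    | one => simp
    | mul x y hx hy h1 h2 => exact hmul _ x hx y hy h1 h2
  -- The union of the q⁻¹Sq for q in Q. It is directed because qr = [q,r]rq with [q,r] in S, so qr
  -- conjugates into S whatever q or r does. U is normal with abelian quotient.
  let U : Subgroup G :=
    { carrier := {w | ∃ q ∈ Q, q * w * q⁻¹ ∈ S}
      one_mem' := ⟨1, one_mem _, by simp⟩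
      mul_mem' := by
        rintro v w ⟨q, hq, hv⟩ ⟨r, hr, hw⟩
        refine ⟨q * r, mul_mem hq hr, ?_⟩
        rw [show q * r * (v * w) * (q * r)⁻¹ =
          (⁅q, r⁆ * (r * (q * v * q⁻¹) * r⁻¹) * ⁅q, r⁆⁻¹) * (q * (r * w * r⁻¹) * q⁻¹) by
            simp only [commutatorElement_def]; group]
        have h := hcomm r hr q hq
        exact mul_mem (mul_mem (mul_mem h (hQ r hr _ hv)) (inv_mem h)) (hQ q hq _ hw)
      inv_mem' := by
        rintro v ⟨q, hq, hv⟩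
        refine ⟨q, hq, ?_⟩
        rw [show q * v⁻¹ * q⁻¹ = (q * v * q⁻¹)⁻¹ by group]
        exact inv_mem hv }
  have hSU : S ≤ U := fun s hs => ⟨1, one_mem _, by simpa using hs⟩
  have hU : U.Normal := by
    rw [← Subgroup.normalizer_eq_top_iff, eq_top_iff, ← htop, Subgroup.closure_le]
    rintro x (⟨i, rfl⟩ | hx)
    · rw [SetLike.mem_coe, Subgroup.mem_normalizer_iff]
      intro w
      constructor
      · rintro ⟨q, hq, h⟩
        refine ⟨q, hq, ?_⟩
        rw [show q * (g i * w * (g i)⁻¹) * q⁻¹ =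
          ⁅q, g i⁆ * (g i * (q * w * q⁻¹) * (g i)⁻¹) * ⁅q, g i⁆⁻¹ by
            simp only [commutatorElement_def]; group]
        have h' := hgQ i q hq
        exact mul_mem (mul_mem h' (hg i _ h)) (inv_mem h')
      · rintro ⟨q, hq, h⟩
        refine ⟨q * g i, mul_mem hq (hQg i), ?_⟩
        rw [show q * g i * w * (q * g i)⁻¹ = q * (g i * w * (g i)⁻¹) * q⁻¹ by group]
        exact h
    · exact Subgroup.le_normalizer (hSU hx)
  have hgen : ∀ x ∈ Set.range g ∪ S, ∀ y ∈ Set.range g ∪ S,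
      Commute (QuotientGroup.mk' U x) (QuotientGroup.mk' U y) := by
    intro x hx y hy
    rw [← commutatorElement_eq_one_iff_commute, ← map_commutatorElement,
      QuotientGroup.mk'_apply, QuotientGroup.eq_one_iff]
    exact hSU (hcomm y (Submonoid.subset_closure hy) x (Submonoid.subset_closure hx))
  have hgen' : ∀ x, ∀ y ∈ Set.range g ∪ S,
      Commute (QuotientGroup.mk' U x) (QuotientGroup.mk' U y) := by
    intro x y hy
    have hx : x ∈ Subgroup.closure (Set.range g ∪ S) := htop ▸ Subgroup.mem_top x
    induction hx using Subgroup.closure_induction with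
    | mem x hx => exact hgen x hx y hy
    | one => simp
    | mul x z _ _ h1 h2 => rw [map_mul]; exact h1.mul_left h2
    | inv x _ h => rw [map_inv]; exact h.inv_left
  have hle : commutator G ≤ U := by
    rw [commutator_def, Subgroup.commutator_le]
    rintro x - y -
    rw [← QuotientGroup.eq_one_iff, ← QuotientGroup.mk'_apply, map_commutatorElement,
      commutatorElement_eq_one_iff_commute]
    have hy : y ∈ Subgroup.closure (Set.range g ∪ S) := htop ▸ Subgroup.mem_top y
    induction hy using Subgroup.closure_induction with
    | mem y hy => exact hgen' x y hy
    | one => simp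
    | mul y z _ _ h1 h2 => rw [map_mul]; exact h1.mul_right h2
    | inv y _ h => rw [map_inv]; exact h.inv_right
  obtain ⟨q, _, h⟩ := hle hw
  exact ⟨q, h⟩

end Contraction

/-! ### Translation lengths on the rays -/

section Translation

variable {n : ℕ}

/-- `g` maps `(k, p)` to `(k, p + a)` for all large `p`. -/
def TranslatesBy (g : Equiv.Perm (Rays n)) (k : Fin n) (a : ℤ) : Prop :=
  ∃ N : ℕ, ∀ p : ℕ+, N < p → (g (k, p)).1 = k ∧ (((g (k, p)).2 : ℕ) : ℤ) = ((p : ℕ) : ℤ) + a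

namespace TranslatesBy

variable {g h : Equiv.Perm (Rays n)} {k : Fin n} {a b : ℤ}

theorem one (k : Fin n) : TranslatesBy 1 k 0 := ⟨0, fun p _ => by simp⟩

theorem mul (hg : TranslatesBy g k a) (hh : TranslatesBy h k b) :
    TranslatesBy (g * h) k (a + b) := by
  obtain ⟨N, hN⟩ := hg
  obtain ⟨M, hM⟩ := hh
  refine ⟨max M (N + b.natAbs), fun p hp => ?_⟩
  obtain ⟨h1, h2⟩ := hM p (lt_of_le_of_lt (le_max_left _ _) hp)
  have e : h (k, p) = (k, (h (k, p)).2) := Prod.ext h1 rfl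
  obtain ⟨h3, h4⟩ := hN (h (k, p)).2 (by have := lt_of_le_of_lt (le_max_right _ _) hp; omega)
  rw [← e] at h3 h4
  rw [Equiv.Perm.mul_apply]
  exact ⟨h3, by omega⟩

theorem inv (hg : TranslatesBy g k a) : TranslatesBy g⁻¹ k (-a) := by
  obtain ⟨N, hN⟩ := hg
  refine ⟨N + a.natAbs, fun p hp => ?_⟩
  have hpos : 0 < ((p : ℤ) - a).toNat := by omega
  obtain ⟨h1, h2⟩ := hN ⟨((p : ℤ) - a).toNat, hpos⟩ (by rw [PNat.mk_coe]; omega)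
  rw [PNat.mk_coe] at h2
  have e : g (k, ⟨((p : ℤ) - a).toNat, hpos⟩) = (k, p) := by
    refine Prod.ext h1 (PNat.coe_injective ?_)
    change ((g (k, ⟨((p : ℤ) - a).toNat, hpos⟩)).2 : ℕ) = (p : ℕ)
    omega
  rw [← Equiv.Perm.eq_inv_iff_eq] at e
  rw [← e]
  refine ⟨rfl, ?_⟩
  rw [PNat.mk_coe]
  omega

theorem zpow (hg : TranslatesBy g k a) (z : ℤ) : TranslatesBy (g ^ z) k (z * a) := by
  induction z with
  | zero => simpa using one k
  | succ m ih => rw [zpow_add_one, add_mul, one_mul]; exact ih.mul hg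
  | pred m ih => rw [zpow_sub_one, sub_mul, one_mul, sub_eq_add_neg]; exact ih.mul hg.inv

theorem unique (hg : TranslatesBy g k a) (hg' : TranslatesBy g k b) : a = b := by
  obtain ⟨N, hN⟩ := hg
  obtain ⟨M, hM⟩ := hg'
  have h1 := (hN ⟨N + M + 1, Nat.succ_pos _⟩ (by rw [PNat.mk_coe]; omega)).2
  have h2 := (hM ⟨N + M + 1, Nat.succ_pos _⟩ (by rw [PNat.mk_coe]; omega)).2
  omega

theorem swap (x y : Rays n) (k : Fin n) : TranslatesBy (Equiv.swap x y) k 0 := by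
  refine ⟨x.2 + y.2, fun p hp => ?_⟩
  rw [Equiv.swap_apply_of_ne_of_ne]
  · simp
  · rintro rfl; simp at hp
  · rintro rfl; simp at hp

end TranslatesBy

theorem IsEventualTranslation.exists_translatesBy {g : Equiv.Perm (Rays n)}
    (hg : IsEventualTranslation g) : ∃ m : Fin n → ℤ, ∀ k, TranslatesBy g k (m k) := by
  obtain ⟨m, K, hK, hm⟩ := hg
  refine ⟨m, fun k => ?_⟩
  obtain ⟨N, hN⟩ := (hK.image fun x : Rays n => (x.2 : ℕ)).bddAbove
  exact ⟨N, fun p hp => hm k p fun hmem => absurd (hN ⟨_, hmem, rfl⟩) (by simpa using hp)⟩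

theorem exists_uniform_bound {g : Equiv.Perm (Rays n)} {m : Fin n → ℤ}
    (hg : ∀ k, TranslatesBy g k (m k)) :
    ∃ N : ℕ, ∀ (k : Fin n) (p : ℕ+), N < p →
      (g (k, p)).1 = k ∧ (((g (k, p)).2 : ℕ) : ℤ) = ((p : ℕ) : ℤ) + m k := by
  choose N hN using hg
  exact ⟨Finset.univ.sup N, fun k p hp =>
    hN k p (lt_of_le_of_lt (Finset.le_sup (Finset.mem_univ k)) hp)⟩

theorem finite_setOf_snd_le (N : ℕ) : {x : Rays n | (x.2 : ℕ) ≤ N}.Finite := by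
  refine (Set.finite_univ.prod (Set.finite_Iic (⟨N + 1, Nat.succ_pos _⟩ : ℕ+))).subset ?_
  rintro ⟨k, p⟩ hx
  refine ⟨Set.mem_univ _, ?_⟩
  change (p : ℕ) ≤ N + 1
  have : (p : ℕ) ≤ N := hx
  omega

/-- An eventual translation that moves no ray inwards moves no ray outwards either. -/
theorem eq_zero_of_translatesBy_nonneg {g : Equiv.Perm (Rays n)} {m : Fin n → ℤ}
    (hg : ∀ k, TranslatesBy g k (m k)) (hm : ∀ k, 0 ≤ m k) (k : Fin n) : m k = 0 := by
  obtain ⟨N, hN⟩ := exists_uniform_bound hg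
  have hout : ∀ x : Rays n, N < x.2 →
      (g x).1 = x.1 ∧ (((g x).2 : ℕ) : ℤ) = ((x.2 : ℕ) : ℤ) + m x.1 := fun x hx => hN x.1 x.2 hx
  -- Beyond N, `g` never moves points inwards, so `g.symm` maps this finite set injectively, hence
  -- bijectively, to itself. The preimage of (k, N + 1) then lies beyond N, which forces m k ≤ 0.
  have hmaps : Set.MapsTo g.symm {x : Rays n | (x.2 : ℕ) ≤ N} {x | (x.2 : ℕ) ≤ N} := by
    intro x hx
    change ((g.symm x).2 : ℕ) ≤ N
    by_contra! h
    have h2 := (hout _ h).2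
    have h3 := hm (g.symm x).1
    rw [Equiv.apply_symm_apply] at h2
    have : (x.2 : ℕ) ≤ N := hx
    omega
  have hsurj := (((finite_setOf_snd_le N).injOn_iff_bijOn_of_mapsTo hmaps).1
    g.symm.injective.injOn).surjOn
  have hx : N < ((g.symm (k, ⟨N + 1, Nat.succ_pos _⟩)).2 : ℕ) := by
    by_contra! h
    obtain ⟨y, hy, e⟩ := hsurj h
    rw [g.symm.injective.eq_iff] at e
    subst e
    have : N + 1 ≤ N := hy
    omega
  obtain ⟨h1, h2⟩ := hout _ hx
  have h3 := hm (g.symm (k, ⟨N + 1, Nat.succ_pos _⟩)).1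
  rw [Equiv.apply_symm_apply] at h1 h2
  simp only [PNat.mk_coe] at h1 h2
  rw [← h1] at h2 h3
  omega

/-! ### Generation of Houghton's group -/

theorem shiftPerm_first_one (i : Fin (n - 1)) :
    shiftPerm n i (firstRay i, 1) = (otherRay i, 1) := by
  simp [shiftPerm]

theorem shiftPerm_first_succ (i : Fin (n - 1)) (p : ℕ+) :
    shiftPerm n i (firstRay i, p + 1) = (firstRay i, p) := by
  have hp1 : p + 1 ≠ 1 := (PNat.lt_add_left 1 p).ne'
  simp [shiftPerm, hp1]

theorem shiftPerm_other (i : Fin (n - 1)) (p : ℕ+) :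
    shiftPerm n i (otherRay i, p) = (otherRay i, p + 1) := by
  simp [shiftPerm, otherRay_ne]

theorem shiftPerm_of_ne {i : Fin (n - 1)} {k : Fin n} (h1 : k ≠ firstRay i) (h2 : k ≠ otherRay i)
    (p : ℕ+) : shiftPerm n i (k, p) = (k, p) := by
  simp [shiftPerm, h1, h2]

theorem otherRay_injective : Function.Injective (otherRay (n := n)) := by
  intro i j h
  have := congrArg Fin.val h
  simp only [otherRay] at this
  exact Fin.ext (by omega)

theorem eq_firstRay_or_otherRay (i : Fin (n - 1)) (k : Fin n) :
    k = firstRay i ∨ ∃ j, k = otherRay j := by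
  by_cases h : (k : ℕ) = 0
  · exact Or.inl (Fin.ext h)
  · exact Or.inr ⟨⟨k - 1, by omega⟩, Fin.ext (by simp only [otherRay]; omega)⟩

theorem translatesBy_shiftPerm (i j : Fin (n - 1)) :
    TranslatesBy (shiftPerm n i) (otherRay j) (if j = i then 1 else 0) := by
  refine ⟨0, fun p _ => ?_⟩
  split_ifs with h
  · subst h; simp [shiftPerm_other]
  · rw [shiftPerm_of_ne (i := i) (otherRay_ne j) (otherRay_injective.ne h)]; simp

/-- The permutations underlying the generators of Houghton's group. -/
def generatingPerms (n : ℕ) (hn : 0 < n) : Set (Equiv.Perm (Rays n)) :=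
  Set.range (shiftPerm n) ∪ {Equiv.swap (⟨0, hn⟩, 1) (⟨0, hn⟩, 2)}

theorem swap_mem_of_apply_mem {X : Type*} [DecidableEq X] {C : Subgroup (Equiv.Perm X)}
    {f : Equiv.Perm X} (hf : f ∈ C) {x y : X} (h : Equiv.swap (f x) (f y) ∈ C) :
    Equiv.swap x y ∈ C := by
  have := mul_mem (mul_mem (inv_mem hf) h) hf
  rw [Equiv.swap_apply_apply] at this
  simpa [mul_assoc] using this

/-- It suffices to reach the transpositions that move the first point of the first ray. Conjugation
by shifts carries known transpositions one step along a ray, and composing those with a common point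
closes each induction. -/
theorem swap_mem_closure (hn : 3 ≤ n) (x y : Rays n) :
    Equiv.swap x y ∈ Subgroup.closure (generatingPerms n (by omega)) := by
  set C := Subgroup.closure (generatingPerms n (by omega))
  have hg : ∀ i, shiftPerm n i ∈ C := fun i => Subgroup.subset_closure (Or.inl ⟨i, rfl⟩)
  let o : Fin (n - 1) := ⟨0, by omega⟩
  have h0 : Equiv.swap ((firstRay o, 1) : Rays n) (firstRay o, 2) ∈ C :=
    Subgroup.subset_closure (Or.inr rfl)
  have hfirst : ∀ p : ℕ+, Equiv.swap ((firstRay o, 1) : Rays n) (firstRay o, p) ∈ C := by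
    intro p
    induction p using PNat.recOn with
    | one => rw [Equiv.swap_self]; exact one_mem C
    | succ p ih =>
      refine SubmonoidClass.swap_mem_trans C h0 (swap_mem_of_apply_mem (hg o) ?_)
      rw [show (2 : ℕ+) = 1 + 1 from rfl, shiftPerm_first_succ, shiftPerm_first_succ]
      exact ih
  have hother : ∀ (i : Fin (n - 1)) (p : ℕ+),
      Equiv.swap ((firstRay o, 1) : Rays n) (otherRay i, p) ∈ C := by
    intro i p
    have h1 : Equiv.swap ((firstRay o, 1) : Rays n) (otherRay i, 1) ∈ C := by
      have := mul_mem (mul_mem (hg i) h0) (inv_mem (hg i))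
      rw [← Equiv.swap_apply_apply, show (2 : ℕ+) = 1 + 1 from rfl] at this
      change Equiv.swap (shiftPerm n i (firstRay i, 1)) (shiftPerm n i (firstRay i, 1 + 1)) ∈ C
        at this
      rw [shiftPerm_first_one, shiftPerm_first_succ, Equiv.swap_comm] at this
      exact this
    induction p using PNat.recOn with
    | one => exact h1
    | succ p ih =>
      have := mul_mem (mul_mem (hg i) ih) (inv_mem (hg i))
      rw [← Equiv.swap_apply_apply] at this
      change Equiv.swap (shiftPerm n i (firstRay i, 1)) (shiftPerm n i (otherRay i, p)) ∈ C
        at this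
      rw [shiftPerm_first_one, shiftPerm_other] at this
      exact SubmonoidClass.swap_mem_trans C h1 this
  have hall : ∀ z : Rays n, Equiv.swap ((firstRay o, 1) : Rays n) z ∈ C := by
    rintro ⟨k, p⟩
    rcases eq_firstRay_or_otherRay o k with rfl | ⟨i, rfl⟩
    · exact hfirst p
    · exact hother i p
  exact SubmonoidClass.swap_mem_trans C (by rw [Equiv.swap_comm]; exact hall x) (hall y)

theorem exists_mem_closure_translatesBy (hn : 0 < n) (a : Fin (n - 1) → ℤ) :
    ∃ c ∈ Subgroup.closure (generatingPerms n hn), ∀ i, TranslatesBy c (otherRay i) (a i) := by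
  have key : ∀ s : Finset (Fin (n - 1)), ∃ c ∈ Subgroup.closure (generatingPerms n hn),
      ∀ i, TranslatesBy c (otherRay i) (if i ∈ s then a i else 0) := by
    intro s
    induction s using Finset.induction_on with
    | empty => exact ⟨1, one_mem _, fun i => by simpa using TranslatesBy.one _⟩
    | insert j s hj ih =>
      obtain ⟨c, hc, h⟩ := ih
      have hj' : shiftPerm n j ∈ Subgroup.closure (generatingPerms n hn) :=
        Subgroup.subset_closure (Or.inl ⟨j, rfl⟩)
      refine ⟨shiftPerm n j ^ a j * c, mul_mem (zpow_mem hj' _) hc, fun i => ?_⟩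
      have := ((translatesBy_shiftPerm j i).zpow (a j)).mul (h i)
      by_cases hij : i = j
      · subst hij; simpa [hj] using this
      · simpa [hij] using this
  obtain ⟨c, hc, h⟩ := key Finset.univ
  exact ⟨c, hc, fun i => by simpa using h i⟩

/-- The shifts and the transposition generate the group of all eventual translations. -/
theorem IsEventualTranslation.mem_closure (hn : 3 ≤ n) {f : Equiv.Perm (Rays n)}
    (hf : IsEventualTranslation f) : f ∈ Subgroup.closure (generatingPerms n (by omega)) := by
  set C := Subgroup.closure (generatingPerms n (by omega))
  let o : Fin (n - 1) := ⟨0, by omega⟩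
  obtain ⟨m, hm⟩ := hf.exists_translatesBy
  obtain ⟨c, hc, hcm⟩ := exists_mem_closure_translatesBy (n := n) (by omega)
    fun i => m (otherRay i)
  have hct : IsEventualTranslation c := by
    refine Subgroup.closure_induction (p := fun c _ => IsEventualTranslation c) ?_
      (IsEventualTranslation.one n) (fun _ _ _ _ h h' => h.mul h') (fun _ _ h => h.inv) hc
    rintro _ (⟨i, rfl⟩ | rfl)
    · exact isEventualTranslation_shiftPerm n i
    · exact isEventualTranslation_swap _ _
  obtain ⟨m', hm'⟩ := hct.exists_translatesBy
  have hd : ∀ k, TranslatesBy (f * c⁻¹) k (m k - m' k) := fun k => by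
    rw [sub_eq_add_neg]; exact (hm k).mul (hm' k).inv
  have hother : ∀ i, m (otherRay i) - m' (otherRay i) = 0 := fun i => by
    rw [(hm' (otherRay i)).unique (hcm i), sub_self]
  -- Only the first ray can still be translated, so either the quotient or its inverse has all
  -- translation lengths nonnegative.
  have hzero : ∀ k, m k - m' k = 0 := by
    rcases le_total 0 (m (firstRay o) - m' (firstRay o)) with h | h
    · refine eq_zero_of_translatesBy_nonneg hd fun k => ?_
      rcases eq_firstRay_or_otherRay o k with rfl | ⟨i, rfl⟩
      · exact h
      · exact (hother i).ge
    · intro k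
      rw [← neg_eq_zero]
      refine eq_zero_of_translatesBy_nonneg (fun k => (hd k).inv) (fun k => ?_) k
      rcases eq_firstRay_or_otherRay o k with rfl | ⟨i, rfl⟩
      · exact neg_nonneg.2 h
      · rw [hother i, neg_zero]
  obtain ⟨N, hN⟩ := exists_uniform_bound hd
  have hfin : f * c⁻¹ ∈ Subgroup.closure {σ : Equiv.Perm (Rays n) | σ.IsSwap} := by
    rw [mem_closure_isSwap']
    refine (finite_setOf_snd_le N).subset fun x hx => ?_
    change (x.2 : ℕ) ≤ N
    by_contra! h
    obtain ⟨h1, h2⟩ := hN x.1 x.2 h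
    rw [hzero, add_zero] at h2
    exact hx (Prod.ext h1 (PNat.coe_injective (by exact_mod_cast h2)))
  have hle : Subgroup.closure {σ : Equiv.Perm (Rays n) | σ.IsSwap} ≤ C := by
    rw [Subgroup.closure_le]
    rintro _ ⟨x, y, -, rfl⟩
    exact swap_mem_closure hn x y
  have := mul_mem (hle hfin) hc
  rwa [inv_mul_cancel_right] at this

end Translation

/-! ### The presented group and its map to Houghton's group -/

section Presentation

variable {n : ℕ}

/-- Used in both directions: to define homomorphisms out of the presented group, and to obtain
`Relations` inside it. -/
theorem map_relators_eq_one_iff (hn : 3 ≤ n) {G : Type*} [Group G]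
    (F : FreeGroup (Gen n) →* G) :
    (∀ r ∈ relators n hn, F r = 1) ↔
      Relations (⟨0, by omega⟩ : Fin (n - 1)) (fun i => F (gWord i)) (F (alphaWord n)) := by
  constructor
  · intro h
    have h1 := h _ (Or.inl (Or.inl (Or.inl rfl)))
    have h2 := h _ (Or.inl (Or.inl (Or.inr (Or.inl rfl))))
    have h3 := h _ (Or.inl (Or.inl (Or.inr (Or.inr rfl))))
    refine ⟨?_, ?_, ?_, fun i j hij => ?_, fun i j => ?_⟩
    · simpa [sq] using h1
    · simpa [conj] using h2
    · rw [map_commutatorElement, commutatorElement_eq_one_iff_commute] at h3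
      simpa [conj] using h3
    · have := h _ (Or.inl (Or.inr ⟨i, j, hij, rfl⟩))
      rw [map_mul, map_inv, mul_inv_eq_one, map_commutatorElement, commutatorElement_def,
        mul_inv_eq_iff_eq_mul, mul_inv_eq_iff_eq_mul] at this
      rw [this, mul_assoc]
    · by_cases hij : i = j
      · rw [hij]
      · have := h _ (Or.inr ⟨i, j, hij, rfl⟩)
        rw [map_mul, map_inv, mul_inv_eq_one] at this
        simpa [conj] using this
  · rintro ⟨h1, h2, h3, h4, h5⟩ r (((rfl | rfl | rfl) | ⟨i, j, hij, rfl⟩) | ⟨i, j, hij, rfl⟩)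
    · simpa [sq] using h1
    · simpa [conj] using h2
    · rw [map_commutatorElement, commutatorElement_eq_one_iff_commute]
      simpa [conj] using h3
    · rw [map_mul, map_inv, mul_inv_eq_one, map_commutatorElement, commutatorElement_def,
        mul_inv_eq_iff_eq_mul, mul_inv_eq_iff_eq_mul, h4 i j hij, mul_assoc]
    · rw [map_mul, map_inv, mul_inv_eq_one]
      simpa [conj] using h5 i j

theorem two_eq_add_one : (2 : ℕ+) = 1 + 1 := rfl

theorem shiftPerm_symm_first (i j : Fin (n - 1)) (p : ℕ+) :
    (shiftPerm n i)⁻¹ (firstRay j, p) = (firstRay j, p + 1) := by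
  rw [Equiv.Perm.inv_eq_iff_eq]
  exact (shiftPerm_first_succ i p).symm

theorem inv_mul_swap_mul {X : Type*} [DecidableEq X] (f : Equiv.Perm X) (x y : X) :
    f⁻¹ * (Equiv.swap x y * f) = Equiv.swap (f⁻¹ x) (f⁻¹ y) := by
  rw [Equiv.swap_apply_apply, inv_inv, mul_assoc]

/-- Shifts along two lines that share the first ray commute up to the transposition. -/
theorem shiftPerm_mul_shiftPerm {i j : Fin (n - 1)} (hij : i ≠ j) :
    shiftPerm n j * shiftPerm n i =
      shiftPerm n i * shiftPerm n j * Equiv.swap (firstRay i, 1) (firstRay i, 2) := by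
  have hf : firstRay j = firstRay i := rfl
  have h1 := shiftPerm_first_one i
  have h2 := shiftPerm_first_succ i
  have h3 := shiftPerm_first_one j
  have h4 := shiftPerm_first_succ j
  have h5 := shiftPerm_of_ne (i := j) (otherRay_ne i) (otherRay_injective.ne hij)
  have h6 := shiftPerm_of_ne (i := i) (otherRay_ne j) (otherRay_injective.ne hij.symm)
  rw [hf] at h3 h4
  rw [two_eq_add_one]
  have hsw : ∀ x : Rays n, x.1 ≠ firstRay i →
      Equiv.swap ((firstRay i, 1) : Rays n) (firstRay i, 1 + 1) x = x := fun x hx =>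
    Equiv.swap_apply_of_ne_of_ne (fun h => hx (by rw [h])) (fun h => hx (by rw [h]))
  refine Equiv.ext fun ⟨k, p⟩ => ?_
  simp only [Equiv.Perm.mul_apply]
  by_cases hk : k = firstRay i
  · subst hk
    induction p using PNat.recOn with
    | one => rw [h1, h5, Equiv.swap_apply_left, h4, h1]
    | succ p =>
      induction p using PNat.recOn with
      | one => rw [h2, h3, Equiv.swap_apply_right, h3, h6]
      | succ p =>
        have hp : (1 : ℕ+) < p + 1 := PNat.lt_add_left 1 p
        have hp' : (1 : ℕ+) + 1 < p + 1 + 1 := by gcongr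
        rw [Equiv.swap_apply_of_ne_of_ne, h2, h4, h4, h2]
        · simp [(PNat.lt_add_left 1 (p + 1)).ne']
        · simp [hp'.ne']
  · rw [hsw _ hk]
    by_cases hi : k = otherRay i
    · subst hi
      rw [shiftPerm_other, h5, h5, shiftPerm_other]
    · by_cases hj : k = otherRay j
      · subst hj
        rw [shiftPerm_other, h6, h6, shiftPerm_other]
      · rw [shiftPerm_of_ne hk hi, shiftPerm_of_ne (i := j) hk hj, shiftPerm_of_ne hk hi]

theorem op_ext {X : Subgroup (Equiv.Perm (Rays n))ᵐᵒᵖ} {x y : X}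
    (h : (x : (Equiv.Perm (Rays n))ᵐᵒᵖ).unop = (y : (Equiv.Perm (Rays n))ᵐᵒᵖ).unop) : x = y :=
  Subtype.ext (MulOpposite.unop_injective h)

/-- The conjugate of α in the cube relation is a transposition sharing exactly one point with α; the
one in the commutation relation exchanges points 3 and 4 of the first ray, so is disjoint from α.
Products appear reversed after `unop`. -/
theorem relations_group (hn : 3 ≤ n) :
    Relations (⟨0, by omega⟩ : Fin (n - 1)) (shift n) (transposition n (by omega)) := by
  set o : Fin (n - 1) := ⟨0, by omega⟩
  have hswap : (transposition n (by omega) : (Equiv.Perm (Rays n))ᵐᵒᵖ) =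
      MulOpposite.op (Equiv.swap (firstRay o, 1) (firstRay o, 2)) := rfl
  have hshift : ∀ i, (shift n i : (Equiv.Perm (Rays n))ᵐᵒᵖ) = MulOpposite.op (shiftPerm n i) :=
    fun _ => rfl
  refine ⟨op_ext ?_, op_ext ?_, op_ext ?_, fun i j hij => op_ext ?_, fun i j => op_ext ?_⟩
  · simp [hswap]
  · have e : (shiftPerm n o) * (Equiv.swap (firstRay o, 1) (firstRay o, 2)) * (shiftPerm n o)⁻¹
        = Equiv.swap (otherRay o, 1) (firstRay o, 1) := by
      rw [← Equiv.swap_apply_apply, two_eq_add_one, shiftPerm_first_succ, shiftPerm_first_one]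
    have hne : ((otherRay o, 1) : Rays n) ≠ (firstRay o, 1) := by simp [otherRay_ne]
    have hne' : ((otherRay o, 1) : Rays n) ≠ (firstRay o, 2) := by simp [otherRay_ne]
    have h2 : ((firstRay o, 2) : Rays n) ≠ (firstRay o, 1) := by simp
    simp only [Subgroup.coe_pow, Subgroup.coe_mul, Subgroup.coe_inv, hswap, hshift,
      MulOpposite.unop_pow, MulOpposite.unop_mul, MulOpposite.unop_inv, MulOpposite.unop_op,
      Subgroup.coe_one, MulOpposite.unop_one]
    rw [← mul_assoc, e]
    set u := Equiv.swap ((otherRay o, 1) : Rays n) (firstRay o, 1) with hu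
    set v := Equiv.swap ((firstRay o, 1) : Rays n) (firstRay o, 2) with hv
    have e1 : v * u * v = Equiv.swap (firstRay o, 2) (otherRay o, 1) :=
      Equiv.swap_mul_swap_mul_swap hne hne'
    have e2 : u * v * u = Equiv.swap (firstRay o, 2) (otherRay o, 1) := by
      rw [hu, hv, Equiv.swap_comm (otherRay o, 1), Equiv.swap_comm (firstRay o, 1) (firstRay o, 2),
        Equiv.swap_mul_swap_mul_swap h2 hne'.symm, Equiv.swap_comm]
    calc (u * v) ^ 3 = (u * v * u) * (v * u * v) := by
          simp only [pow_succ, pow_zero, one_mul, mul_assoc]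
      _ = 1 := by rw [e1, e2, Equiv.swap_mul_self]
  · have e : ((shiftPerm n o) ^ 2)⁻¹ * ((Equiv.swap (firstRay o, 1) (firstRay o, 2)) *
        (shiftPerm n o) ^ 2) = Equiv.swap (firstRay o, 1 + 1 + 1) (firstRay o, 1 + 1 + 1 + 1) := by
      rw [inv_mul_swap_mul, sq, mul_inv_rev]
      simp only [Equiv.Perm.mul_apply, shiftPerm_symm_first, two_eq_add_one]
    simp only [Subgroup.coe_pow, Subgroup.coe_mul, Subgroup.coe_inv, hswap, hshift,
      MulOpposite.unop_pow, MulOpposite.unop_mul, MulOpposite.unop_inv, MulOpposite.unop_op]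
    rw [e]
    have h1 : (1 : ℕ+) + 1 + 1 = 3 := rfl
    have h2 : (3 : ℕ+) + 1 = 4 := rfl
    rw [h1, h2]
    have hnodup : [((firstRay o, 1) : Rays n), (firstRay o, 2), (firstRay o, 3),
        (firstRay o, 4)].Nodup :=
      List.Nodup.map (f := fun p : ℕ+ => (firstRay o, p)) (l := [1, 2, 3, 4])
        (fun _ _ h => congrArg Prod.snd h) (by decide)
    exact (Equiv.Perm.disjoint_swap_swap hnodup).commute.eq.symm
  · simp only [Subgroup.coe_mul, hswap, hshift, MulOpposite.unop_mul, MulOpposite.unop_op]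
    exact shiftPerm_mul_shiftPerm hij
  · simp only [Subgroup.coe_mul, Subgroup.coe_inv, hswap, hshift, MulOpposite.unop_mul,
      MulOpposite.unop_inv, MulOpposite.unop_op, inv_mul_swap_mul, shiftPerm_symm_first]

/-- The elements of Houghton's group named by the abstract generators. -/
def generator (hn : 3 ≤ n) : Gen n → group n
  | Gen.g i => shift n i
  | Gen.alpha => transposition n (by omega)

/-- The natural map from the presented group to Houghton's group. -/
def toHoughton (hn : 3 ≤ n) : PresentedGroup (relators n hn) →* group n :=
  PresentedGroup.toGroup (f := generator hn) <| by
    rw [map_relators_eq_one_iff]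
    simp only [gWord, alphaWord, FreeGroup.lift_apply_of]
    exact relations_group hn

theorem toHoughton_g (hn : 3 ≤ n) (i : Fin (n - 1)) :
    toHoughton hn (PresentedGroup.of (Gen.g i)) = shift n i :=
  PresentedGroup.toGroup.of _

theorem toHoughton_alpha (hn : 3 ≤ n) :
    toHoughton hn (PresentedGroup.of Gen.alpha) = transposition n (by omega) :=
  PresentedGroup.toGroup.of _

theorem toHoughton_surjective (hn : 3 ≤ n) : Function.Surjective (toHoughton hn) := by
  have key : Subgroup.closure (generatingPerms n (by omega)) ≤
      ((toHoughton hn).range.map (group n).subtype).unop := by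
    rw [Subgroup.closure_le]
    rintro _ (⟨i, rfl⟩ | rfl)
    · exact ⟨_, ⟨PresentedGroup.of (Gen.g i), rfl⟩, congrArg Subtype.val (toHoughton_g hn i)⟩
    · exact ⟨_, ⟨PresentedGroup.of Gen.alpha, rfl⟩, congrArg Subtype.val (toHoughton_alpha hn)⟩
  intro h
  obtain ⟨_, ⟨w, rfl⟩, hw⟩ := key (IsEventualTranslation.mem_closure hn h.2)
  exact ⟨w, Subtype.ext hw⟩

theorem relations_presentedGroup (hn : 3 ≤ n) :
    Relations (⟨0, by omega⟩ : Fin (n - 1))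
      (fun i => (PresentedGroup.of (Gen.g i) : PresentedGroup (relators n hn)))
      (PresentedGroup.of Gen.alpha) :=
  (map_relators_eq_one_iff hn (PresentedGroup.mk (relators n hn))).1
    fun _ hr => PresentedGroup.one_of_mem hr

/-! ### Exponent sums and injectivity -/

/-- The exponents of the generator with index `i` in the generators. -/
def generatorExponent (i : Fin (n - 1)) : Gen n → Multiplicative ℤ
  | Gen.g j => Multiplicative.ofAdd (if i = j then 1 else 0)
  | Gen.alpha => 1

/-- The exponent sum of the generator with index `i`. -/
def exponentSum (hn : 3 ≤ n) (i : Fin (n - 1)) :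
    PresentedGroup (relators n hn) →* Multiplicative ℤ :=
  PresentedGroup.toGroup (f := generatorExponent i) <| by
    rw [map_relators_eq_one_iff]
    simp only [gWord, alphaWord, FreeGroup.lift_apply_of, generatorExponent]
    exact ⟨by simp, by simp, by simp, fun _ _ _ => by rw [one_mul, mul_comm], by simp⟩

theorem exponentSum_g (hn : 3 ≤ n) (i j : Fin (n - 1)) :
    exponentSum hn i (PresentedGroup.of (Gen.g j)) =
      Multiplicative.ofAdd (if i = j then 1 else 0) :=
  PresentedGroup.toGroup.of _

theorem exponentSum_alpha (hn : 3 ≤ n) (i : Fin (n - 1)) :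
    exponentSum hn i (PresentedGroup.of Gen.alpha) = 1 :=
  PresentedGroup.toGroup.of _

/-- Among the generators only g_{i+1} translates this ray, and by 1, so the exponent sum depends
only on the image in Houghton's group. -/
theorem translatesBy_exponentSum (hn : 3 ≤ n) (i : Fin (n - 1))
    (w : PresentedGroup (relators n hn)) :
    TranslatesBy (toHoughton hn w : (Equiv.Perm (Rays n))ᵐᵒᵖ).unop (otherRay i)
      (exponentSum hn i w).toAdd := by
  have hw : w ∈ Subgroup.closure (Set.range PresentedGroup.of) := by
    rw [PresentedGroup.closure_range_of]; trivial
  induction hw using Subgroup.closure_induction with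
  | mem x hx =>
    obtain ⟨j | _, rfl⟩ := hx
    · rw [toHoughton_g, exponentSum_g]
      exact translatesBy_shiftPerm j i
    · rw [toHoughton_alpha, exponentSum_alpha]
      exact TranslatesBy.swap _ _ _
  | one => rw [map_one, map_one]; exact TranslatesBy.one _
  | mul x y _ _ hx hy =>
    rw [map_mul, map_mul, toAdd_mul, add_comm]
    exact hy.mul hx
  | inv x _ hx =>
    rw [map_inv, map_inv, toAdd_inv]
    exact hx.inv

/-- The abelianization map factors through the exponent sums, because α is a commutator and dies
there. -/
theorem mem_commutator_of_exponentSum (hn : 3 ≤ n) {w : PresentedGroup (relators n hn)}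
    (hw : ∀ i, exponentSum hn i w = 1) : w ∈ commutator (PresentedGroup (relators n hn)) := by
  have key : (Abelianization.of : PresentedGroup (relators n hn) →* _) =
      ∏ i, (zpowersHom _ (Abelianization.of (PresentedGroup.of (Gen.g i)))).comp
        (exponentSum hn i) := by
    refine PresentedGroup.ext fun x => ?_
    rw [MonoidHom.finsetProd_apply]
    rcases x with j | _
    · rw [Finset.prod_eq_single j]
      · simp [exponentSum_g]
      · intro i _ hi
        simp [exponentSum_g, hi]
      · simp
    -- Here n ≥ 3 supplies two distinct indices, so that α = [g_1, g_2].
    · have h := congrArg Abelianization.of ((relations_presentedGroup hn).swap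
        ⟨0, by omega⟩ ⟨1, by omega⟩ (by simp))
      simp only [map_mul] at h
      rw [mul_comm (Abelianization.of (PresentedGroup.of (Gen.g ⟨0, _⟩))), right_eq_mul] at h
      simp [exponentSum_alpha, h]
  rw [← Abelianization.ker_of, MonoidHom.mem_ker, key, MonoidHom.finsetProd_apply]
  exact Finset.prod_eq_one fun i _ => by simp [hw i]

theorem toHoughton_injective (hn : 3 ≤ n) : Function.Injective (toHoughton hn) := by
  rw [injective_iff_map_eq_one]
  intro w hw
  let o : Fin (n - 1) := ⟨0, by omega⟩
  let g : Fin (n - 1) → PresentedGroup (relators n hn) := fun i => PresentedGroup.of (Gen.g i)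
  let a : PresentedGroup (relators n hn) := PresentedGroup.of Gen.alpha
  have : Nontrivial (Fin (n - 1)) := Fin.nontrivial_iff_two_le.2 (by omega)
  have hR : Relations o g a := relations_presentedGroup hn
  have hcox : CoxeterRelations (sigma (g o) a) :=
    ⟨hR.sigma_mul_self, hR.braid, hR.commute_sigma⟩
  have hcomm : w ∈ commutator _ := mem_commutator_of_exponentSum hn fun i => by
    have h := translatesBy_exponentSum hn i w
    rw [hw] at h
    exact Multiplicative.toAdd.injective (h.unique (TranslatesBy.one _))
  let S : Subgroup (PresentedGroup (relators n hn)) :=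
    Subgroup.closure (Set.range (sigma (g o) a))
  have haS : a ∈ S := Subgroup.subset_closure ⟨0, sigma_zero _ _⟩
  have hconj : ∀ i, ∀ s ∈ S, g i * s * (g i)⁻¹ ∈ S := by
    intro i
    change S ≤ S.comap (MulAut.conj (g i)).toMonoidHom
    rw [Subgroup.closure_le]
    rintro _ ⟨k, rfl⟩
    refine Subgroup.subset_closure ⟨k + 1, ?_⟩
    exact eq_mul_inv_of_mul_eq (hR.semiconjBy i k).symm
  have hc : ∀ i j, ⁅g i, g j⁆ ∈ S := by
    intro i j
    by_cases hij : i = j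
    · rw [hij, commutatorElement_self]; exact one_mem S
    · rw [commutatorElement_def, hR.swap i j hij]
      simpa [mul_assoc] using haS
  have htop : Subgroup.closure (Set.range g ∪ S) = ⊤ := by
    rw [eq_top_iff, ← PresentedGroup.closure_range_of]
    refine Subgroup.closure_mono ?_
    rintro _ ⟨i | _, rfl⟩
    · exact Or.inl ⟨i, rfl⟩
    · exact Or.inr haS
  obtain ⟨q, hq⟩ := exists_conj_mem hconj hc htop hcomm
  -- Positions start at 1, so x_k is the point k + 1 and σ_k exchanges x_k and x_{k+1}.
  let x : ℕ → Rays n := fun k => (firstRay o, k.succPNat)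
  have hx : Function.Injective x := fun k l h =>
    Nat.succPNat_injective (congrArg Prod.snd h)
  have hf : ∀ k, ((group n).subtype.comp (toHoughton hn)) (sigma (g o) a k) =
      MulOpposite.op (Equiv.swap (x k) (x (k + 1))) := by
    intro k
    induction k with
    | zero =>
      rw [sigma_zero]
      exact congrArg Subtype.val (toHoughton_alpha hn)
    | succ k ih =>
      rw [eq_mul_inv_of_mul_eq (semiconjBy_sigma (g o) a k).symm, map_mul, map_mul, map_inv, ih,
        show ((group n).subtype.comp (toHoughton hn)) (g o) = MulOpposite.op (shiftPerm n o) from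
          congrArg Subtype.val (toHoughton_g hn o)]
      apply MulOpposite.unop_injective
      simp only [MulOpposite.unop_mul, MulOpposite.unop_inv, MulOpposite.unop_op,
        inv_mul_swap_mul, x, shiftPerm_symm_first]
      rfl
  have h1 := hcox.eq_one_of_mem_closure hx hf hq (by simp [hw])
  rwa [conj_eq_one_iff] at h1

theorem finite_gen (n : ℕ) : Finite (Gen n) :=
  Finite.of_surjective (fun x : Option (Fin (n - 1)) => x.elim Gen.alpha Gen.g) fun x =>
    match x with
    | Gen.g i => ⟨some i, rfl⟩
    | Gen.alpha => ⟨none, rfl⟩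

theorem finite_relators (hn : 3 ≤ n) : (relators n hn).Finite := by
  refine Set.Finite.union (Set.Finite.union (Set.toFinite _) ?_) ?_
  · refine (Set.finite_range fun x : Fin (n - 1) × Fin (n - 1) =>
      ⁅gWord x.1, gWord x.2⁆ * (alphaWord n)⁻¹).subset ?_
    rintro _ ⟨i, j, -, rfl⟩
    exact ⟨(i, j), rfl⟩
  · refine (Set.finite_range fun x : Fin (n - 1) × Fin (n - 1) =>
      conj (alphaWord n) (gWord x.1)⁻¹ * (conj (alphaWord n) (gWord x.2)⁻¹)⁻¹).subset ?_
    rintro _ ⟨i, j, -, rfl⟩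
    exact ⟨(i, j), rfl⟩

end Presentation

end Houghton

theorem theorem2 (n : ℕ) (hn : 3 ≤ n) :
    Finite (Houghton.Gen n) ∧ (Houghton.relators n hn).Finite ∧
    ∃ e : PresentedGroup (Houghton.relators n hn) ≃* Houghton.group n,
      (∀ i : Fin (n - 1), e (PresentedGroup.of (Houghton.Gen.g i)) = Houghton.shift n i) ∧
      e (PresentedGroup.of Houghton.Gen.alpha) =
        Houghton.transposition n (Nat.lt_of_lt_of_le (Nat.succ_pos 2) hn) :=
  ⟨Houghton.finite_gen n, Houghton.finite_relators hn,
    MulEquiv.ofBijective (Houghton.toHoughton hn)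
      ⟨Houghton.toHoughton_injective hn, Houghton.toHoughton_surjective hn⟩,
    Houghton.toHoughton_g hn, Houghton.toHoughton_alpha hn⟩
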